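/- Let $W$ be a finite irreducible real reflection group of rank $n \ge 1$ acting on Euclidean space $\mathbf{R}^n$ (a finite subgroup of $O(n)$, generated by reflections, leaving no subspace invariant except $0$ and $\mathbf{R}^n$). Let $C$ be a fundamental chamber of $W$ (a connected component of the complement of the reflecting hyperplanes), with inward unit normals $\alpha_1, \dots, \alpha_n$ ordered so that, for some $0 \le s \le n$, both $\{\alpha_1, \dots, \alpha_s\}$ and $\{\alpha_{s+1}, \dots, \alpha_n\}$ are orthonormal sets. Let $R_i$ be the reflection in the hyperplane $\alpha_i^{\perp}$, let $\gamma = R_1 R_2 \cdots R_n$ be the corresponding Coxeter element, let $h$ be the order of $\gamma$, and let $\{\beta_1, \dots, \beta_n\}$ be the dual basis, $\beta_i \cdot \alpha_j = \delta_{ij}$. Reading the indices of the $\alpha$'s, $\beta$'s and $R$'s cyclically modulo $n$, define for every integer $i \ge 1$ \[ \rho_i = R_1 R_2 \cdots R_{i-1}\alpha_i, \qquad \mu_i = R_1 R_2 \cdots R_{i-1}\beta_i . \] Then the following hold. (a) $\mu_i \cdot \rho_j = -\mu_{j+n}\cdot \rho_i$ for all $i, j \ge 1$. (b) $\mu_i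 \cdot \rho_j \ge 0$ for $1 \le i \le j \le nh/2$. (c) $\mu_{i+t} \cdot \rho_i = 0$ for $1 \le t \le n-1$ and all $i \ge 1$. (d) $\mu_j \cdot \rho_i \le 0$ for $1 \le i < j \le nh/2$. -/

import Mathlib

open scoped InnerProductSpace

noncomputable section

namespace ReflGroup

/-- Euclidean `n`-space with its dot product. -/
abbrev E (n : ℕ) : Type := EuclideanSpace ℝ (Fin n)

/-- The orthogonal group `O(n)`, as the group of linear isometries of `ℝⁿ`. -/
abbrev O (n : ℕ) : Type := E n ≃ₗᵢ[ℝ] E n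

/-- The orthogonal reflection in the hyperplane `v^⊥`. -/
def reflectionIn {n : ℕ} (v : E n) : O n := (ℝ ∙ v)ᗮ.reflection

/-- `W` is a finite irreducible real reflection group on `ℝⁿ`: a finite subgroup of `O(n)`,
generated by the reflections it contains, with no invariant subspaces other than `0` and `ℝⁿ`. -/
structure IsFiniteIrreducible {n : ℕ} (W : Subgroup (O n)) : Prop where
  finite : Finite W
  generated : Subgroup.closure {g : O n | g ∈ W ∧ ∃ v : E n, v ≠ 0 ∧ g = reflectionIn v} = W
  irreducible : ∀ U : Submodule ℝ (E n), (∀ g ∈ W, ∀ x ∈ U, g x ∈ U) → U = ⊥ ∨ U = ⊤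

/-- The complement in `ℝⁿ` of the union of the reflecting hyperplanes of `W`. -/
def regularSet {n : ℕ} (W : Subgroup (O n)) : Set (E n) :=
  {x | ∀ v : E n, v ≠ 0 → reflectionIn v ∈ W → ⟪v, x⟫_ℝ ≠ 0}

/-- A chamber of `W`: a connected component of the complement of the reflecting hyperplanes. -/
def IsChamber {n : ℕ} (W : Subgroup (O n)) (C : Set (E n)) : Prop :=
  ∃ x ∈ regularSet W, C = connectedComponentIn (regularSet W) x

/-- `α₁, …, αₙ` are the inward unit normals to the walls of the chamber `C` of `W`:
the `αᵢ` are unit normals of reflecting hyperplanes of `W`, `C` is the intersection of the open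
half-spaces `αᵢ · x > 0`, and none of these half-spaces can be omitted. -/
structure IsInwardUnitNormals {n : ℕ} (W : Subgroup (O n)) (C : Set (E n))
    (α : Fin n → E n) : Prop where
  unit : ∀ i, ‖α i‖ = 1
  refl_mem : ∀ i, reflectionIn (α i) ∈ W
  chamber_eq : C = {x | ∀ i, 0 < ⟪α i, x⟫_ℝ}
  irredundant : ∀ i, ∃ x ∉ C, ∀ j, j ≠ i → 0 < ⟪α j, x⟫_ℝ

/-- `β₁, …, βₙ` is the dual basis to `α₁, …, αₙ`. -/
def IsDualBasis {n : ℕ} (α β : Fin n → E n) : Prop :=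
  ∀ i j, ⟪β i, α j⟫_ℝ = if i = j then 1 else 0

/-- The Coxeter element `γ = R₁R₂⋯Rₙ`, where `Rᵢ` is the reflection in `αᵢ^⊥`. -/
def coxeterElement {n : ℕ} (α : Fin n → E n) : O n :=
  (List.ofFn fun i => reflectionIn (α i)).prod

/-- Cyclic indexing modulo `n`: for a family `v₁, …, vₙ` (stored as `v 0, …, v (n - 1)`) and an
integer `i ≥ 1`, this is `vᵢ`, with the index `i` read modulo `n`. -/
def cyc {n : ℕ} [NeZero n] (v : Fin n → E n) (i : ℕ) : E n :=
  v (Fin.ofNat n (i - 1))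

/-- The product `R₁R₂⋯Rₖ`, indices modulo `n`. -/
def prefixProd {n : ℕ} [NeZero n] (α : Fin n → E n) (k : ℕ) : O n :=
  ((List.range k).map fun m => reflectionIn (cyc α (m + 1))).prod

/-- `ρᵢ = R₁R₂⋯Rᵢ₋₁ αᵢ` for `i ≥ 1`, indices modulo `n`. -/
def rho {n : ℕ} [NeZero n] (α : Fin n → E n) (i : ℕ) : E n :=
  prefixProd α (i - 1) (cyc α i)

/-- `μᵢ = R₁R₂⋯Rᵢ₋₁ βᵢ` for `i ≥ 1`, indices modulo `n`. -/
def mu {n : ℕ} [NeZero n] (α β : Fin n → E n) (i : ℕ) : E n :=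
  prefixProd α (i - 1) (cyc β i)

end ReflGroup

end

noncomputable section

namespace ReflGroup

variable {n : ℕ}

/-! ### Reflections -/

/-! Parts (a) and (c) are formal. A simple reflection fixes every `β` except its own, so one period
of the word gives `γ μ_i = μ_{i+n} = μ_i - 2 ρ_i`, and (a) follows by expanding `γ μ_i · γ μ_j = μ_i
· μ_j`. In (c) the common prefix cancels and leaves an entry of the dual pairing. Part (d) follows
from (c) when `j < i + n`, and otherwise from (a) and (b).

For (b), cancelling a power of `γ` turns `μ_i` into some `β_r`, so the claim is that `ρ_j` is a
positive root for `1 ≤ j ≤ nh/2`. By irreducibility the Gram matrix of the `α`'s has an eigenvector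
`c` with positive entries. The vectors with `α_i · x = c_i f` on the first block and `c_i g` on the
second are preserved by both block reflections, which act on `(f, g)` linearly with the Chebyshev
recursion. Hence `ρ_j · x = c_r (f U_{k+1} + g U_k)`, where `U` is `sineSeq` and `k` counts the full
blocks preceding letter `j` (`inner_rho`).

No root vanishes inside the chamber, so `U` cannot jump from positive to negative: it reaches zero
exactly, at some `K + 1`, and is antiperiodic from there. Then `γ^(K+1)` fixes the point of type
`(1, 1)`, which lies in the chamber, so it is trivial by the exchange condition and `h ≤ K + 1`.
Therefore `U_{k+1} + U_k > 0` for `k < h`, which makes `ρ_j` positive at that point. For odd `h`,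
the bound `k < h` also needs the two blocks to have equal size (`two_mul_eq_of_odd`). -/

theorem reflectionIn_apply (v x : E n) :
    reflectionIn v x = x - (2 * (⟪v, x⟫_ℝ / ‖v‖ ^ 2)) • v := by
  unfold reflectionIn
  rw [Submodule.reflection_orthogonal_apply, Submodule.reflection_singleton_apply]
  simp only [RCLike.ofReal_real_eq_id, id, neg_sub, ← Nat.cast_smul_eq_nsmul ℝ, smul_smul]
  norm_num

theorem reflectionIn_apply_of_unit {v : E n} (hv : ‖v‖ = 1) (x : E n) :
    reflectionIn v x = x - (2 * ⟪v, x⟫_ℝ) • v := by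
  rw [reflectionIn_apply, hv]; norm_num

theorem reflectionIn_reflectionIn (v x : E n) : reflectionIn v (reflectionIn v x) = x :=
  Submodule.reflection_reflection _ x

theorem reflectionIn_mul_self (v : E n) : reflectionIn v * reflectionIn v = 1 :=
  LinearIsometryEquiv.ext fun x => by
    rw [LinearIsometryEquiv.coe_mul, Function.comp_apply, reflectionIn_reflectionIn,
      LinearIsometryEquiv.coe_one, id]

theorem inner_reflectionIn_left (v x y : E n) :
    ⟪reflectionIn v x, y⟫_ℝ = ⟪x, reflectionIn v y⟫_ℝ := by
  rw [← LinearIsometryEquiv.inner_map_map (reflectionIn v) (reflectionIn v x) y]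
  rw [reflectionIn_reflectionIn]

theorem inner_map_left (g : O n) (x y : E n) : ⟪g x, y⟫_ℝ = ⟪x, g⁻¹ y⟫_ℝ := by
  rw [← LinearIsometryEquiv.inner_map_map g x (g⁻¹ y)]
  congr 1
  exact (g.apply_symm_apply y).symm

theorem reflectionIn_smul {c : ℝ} (hc : c ≠ 0) (v : E n) :
    reflectionIn (c • v) = reflectionIn v := by
  unfold reflectionIn
  congr 2
  rw [Submodule.span_singleton_smul_eq hc.isUnit]

theorem reflectionIn_neg (v : E n) : reflectionIn (-v) = reflectionIn v := by
  simpa using reflectionIn_smul (c := -1) (by norm_num) v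

theorem reflectionIn_map (g : O n) (v : E n) :
    reflectionIn (g v) = g * reflectionIn v * g⁻¹ := by
  refine LinearIsometryEquiv.ext fun x => ?_
  rw [LinearIsometryEquiv.coe_mul, LinearIsometryEquiv.coe_mul, Function.comp_apply,
    Function.comp_apply, reflectionIn_apply, reflectionIn_apply, map_sub, map_smul, inner_map_left,
    g.norm_map]
  congr 1
  exact (g.apply_symm_apply x).symm

/-! ### Roots and simple systems -/

/-- A root of `W`: a nonzero normal vector of a reflecting hyperplane. -/
def IsRoot (W : Subgroup (O n)) (v : E n) : Prop := v ≠ 0 ∧ reflectionIn v ∈ W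

theorem IsRoot.map {W : Subgroup (O n)} {v : E n} (hv : IsRoot W v) {g : O n} (hg : g ∈ W) :
    IsRoot W (g v) := by
  refine ⟨by simpa using hv.1, ?_⟩
  rw [reflectionIn_map]
  exact W.mul_mem (W.mul_mem hg hv.2) (W.inv_mem hg)

theorem IsRoot.neg {W : Subgroup (O n)} {v : E n} (hv : IsRoot W v) : IsRoot W (-v) :=
  ⟨neg_ne_zero.mpr hv.1, by rw [reflectionIn_neg]; exact hv.2⟩

/-- Unit roots `α` with dual basis `β` such that no reflecting hyperplane of `W` meets the open
cone cut out by `α`. -/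
structure IsSimpleSystem (W : Subgroup (O n)) (α β : Fin n → E n) : Prop where
  unit : ∀ i, ‖α i‖ = 1
  refl_mem : ∀ i, reflectionIn (α i) ∈ W
  dual : IsDualBasis α β
  regular : ∀ v, IsRoot W v → ∀ x, (∀ i, 0 < ⟪α i, x⟫_ℝ) → ⟪v, x⟫_ℝ ≠ 0

theorem IsDualBasis.inner_left {α β : Fin n → E n} (h : IsDualBasis α β) (i j : Fin n) :
    ⟪α i, β j⟫_ℝ = if i = j then 1 else 0 := by
  rw [real_inner_comm, h]; simp only [eq_comm]

theorem IsDualBasis.linearIndependent {α β : Fin n → E n} (h : IsDualBasis α β) :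
    LinearIndependent ℝ α := by
  rw [Fintype.linearIndependent_iff]
  intro g hg i
  have := congrArg (fun v => ⟪β i, v⟫_ℝ) hg
  simpa [inner_sum, inner_smul_right, h i] using this

theorem IsDualBasis.symm {α β : Fin n → E n} (h : IsDualBasis α β) : IsDualBasis β α :=
  fun i j => h.inner_left i j

theorem IsDualBasis.ext_left {α β : Fin n → E n} (h : IsDualBasis α β) {x y : E n}
    (hxy : ∀ i, ⟪α i, x⟫_ℝ = ⟪α i, y⟫_ℝ) : x = y := by
  have hs : Submodule.span ℝ (Set.range α) = ⊤ :=
    h.linearIndependent.span_eq_top_of_card_eq_finrank' (by simp)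
  refine ext_inner_left ℝ fun v => ?_
  have hv : v ∈ Submodule.span ℝ (Set.range α) := hs ▸ Submodule.mem_top
  induction hv using Submodule.span_induction with
  | mem v hv => obtain ⟨i, rfl⟩ := hv; exact hxy i
  | zero => simp
  | add a b _ _ ha hb => rw [inner_add_left, inner_add_left, ha, hb]
  | smul c a _ ha => rw [inner_smul_left, inner_smul_left, ha]

theorem IsDualBasis.sum_eq {α β : Fin n → E n} (h : IsDualBasis α β) (x : E n) :
    ∑ i, ⟪β i, x⟫_ℝ • α i = x := by
  refine h.symm.ext_left fun j => ?_
  simp [inner_sum, inner_smul_right, h j]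

theorem IsDualBasis.inner_eq_sum {α β : Fin n → E n} (h : IsDualBasis α β) (v x : E n) :
    ⟪v, x⟫_ℝ = ∑ i, ⟪β i, v⟫_ℝ * ⟪α i, x⟫_ℝ := by
  conv_lhs => rw [← h.sum_eq v]
  simp [sum_inner, inner_smul_left]

/-- The vector with prescribed inner products with `α`. -/
theorem IsDualBasis.exists_inner_eq {α β : Fin n → E n} (h : IsDualBasis α β) (f : Fin n → ℝ) :
    ∃ x, ∀ i, ⟪α i, x⟫_ℝ = f i :=
  ⟨∑ i, f i • β i, fun i => by simp [inner_sum, inner_smul_right, h.inner_left i]⟩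

namespace IsSimpleSystem

variable {W : Subgroup (O n)} {α β : Fin n → E n}

theorem isRoot (hS : IsSimpleSystem W α β) (i : Fin n) : IsRoot W (α i) :=
  ⟨fun h => by simpa [h] using hS.unit i, hS.refl_mem i⟩

theorem reflectionIn_apply (hS : IsSimpleSystem W α β) (i : Fin n) (x : E n) :
    reflectionIn (α i) x = x - (2 * ⟪α i, x⟫_ℝ) • α i :=
  reflectionIn_apply_of_unit (hS.unit i) x

/-- A root keeps its sign on the chamber. -/
theorem inner_pos_of_inner_pos (hS : IsSimpleSystem W α β) {v x y : E n} (hv : IsRoot W v)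
    (hx : ∀ i, 0 < ⟪α i, x⟫_ℝ) (hy : ∀ i, 0 < ⟪α i, y⟫_ℝ) (h : 0 < ⟪v, x⟫_ℝ) :
    0 < ⟪v, y⟫_ℝ := by
  by_contra hneg
  have hy' : 0 ≤ -⟪v, y⟫_ℝ := by linarith
  -- A nonnegative combination of `x` and `y` lying in the open cone and orthogonal to `v`.
  refine hS.regular v hv ((-⟪v, y⟫_ℝ) • x + ⟪v, x⟫_ℝ • y) (fun i => ?_) ?_
  · rw [inner_add_right, inner_smul_right, inner_smul_right]
    have := mul_nonneg hy' (hx i).le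
    have := mul_pos h (hy i)
    linarith
  · rw [inner_add_right, inner_smul_right, inner_smul_right]; ring

/-- `β i` lies on the boundary of the cone; the perturbation `β i + ε x` lies inside it, where `v`
is positive, and `ε` is arbitrarily small. -/
theorem coeff_nonneg (hS : IsSimpleSystem W α β) {v x : E n} (hv : IsRoot W v)
    (hx : ∀ i, 0 < ⟪α i, x⟫_ℝ) (h : 0 < ⟪v, x⟫_ℝ) (i : Fin n) : 0 ≤ ⟪β i, v⟫_ℝ := by
  have key : ∀ ε : ℝ, 0 < ε → 0 ≤ ⟪β i, v⟫_ℝ + ε * ⟪v, x⟫_ℝ := fun ε hε => by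
    have := hS.inner_pos_of_inner_pos (y := β i + ε • x) hv hx (fun j => by
      rw [inner_add_right, inner_smul_right, hS.dual.inner_left]
      have := mul_pos hε (hx j)
      split_ifs <;> linarith) h
    rw [inner_add_right, inner_smul_right, real_inner_comm] at this
    exact this.le
  by_contra hneg
  -- This `ε` cancels only half of the negative coefficient.
  have h2 := key (-⟪β i, v⟫_ℝ / (2 * ⟪v, x⟫_ℝ)) (by apply div_pos <;> linarith)
  have h3 : -⟪β i, v⟫_ℝ / (2 * ⟪v, x⟫_ℝ) * ⟪v, x⟫_ℝ = -⟪β i, v⟫_ℝ / 2 := by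
    field_simp
  linarith

theorem coeff_reflectionIn (hS : IsSimpleSystem W α β) {i j : Fin n} (hij : j ≠ i) (v : E n) :
    ⟪β j, reflectionIn (α i) v⟫_ℝ = ⟪β j, v⟫_ℝ := by
  rw [hS.reflectionIn_apply, inner_sub_right, inner_smul_right, hS.dual, if_neg hij]; ring

/-- The only positive roots made negative by a simple reflection are the multiples of the
corresponding simple root. -/
theorem eq_smul_of_reflectionIn_neg (hS : IsSimpleSystem W α β) {v x : E n} {i : Fin n}
    (hv : IsRoot W v) (hx : ∀ i, 0 < ⟪α i, x⟫_ℝ) (h : 0 < ⟪v, x⟫_ℝ)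
    (h' : ⟪reflectionIn (α i) v, x⟫_ℝ < 0) : v = ⟪β i, v⟫_ℝ • α i := by
  have hz : ∀ j, j ≠ i → ⟪β j, v⟫_ℝ = 0 := fun j hj => by
    have h1 := hS.coeff_nonneg hv hx h j
    have h2 := hS.coeff_nonneg (hv.map (hS.refl_mem i)).neg hx (by rw [inner_neg_left]; linarith) j
    rw [inner_neg_right, hS.coeff_reflectionIn hj] at h2
    linarith
  conv_lhs => rw [← hS.dual.sum_eq v]
  exact Finset.sum_eq_single i (fun j _ hj => by rw [hz j hj, zero_smul]) (by simp)

theorem reflectionIn_eq_of_eq_smul {v w : E n} {c : ℝ} (hv : v ≠ 0) (h : v = c • w) :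
    reflectionIn v = reflectionIn w := by
  have hc : c ≠ 0 := by rintro rfl; simp at h; exact hv h
  rw [h, reflectionIn_smul hc]

theorem exists_inner_pos (hS : IsSimpleSystem W α β) : ∃ x, ∀ i, 0 < ⟪α i, x⟫_ℝ := by
  obtain ⟨x, hx⟩ := hS.dual.exists_inner_eq fun _ => 1
  exact ⟨x, fun i => by rw [hx]; norm_num⟩

/-- The root `R_i α_j` has `j`-th coefficient `1`, so it is positive and its `i`-th coefficient `-2
α_i · α_j` cannot be negative. -/
theorem inner_nonpos (hS : IsSimpleSystem W α β) {i j : Fin n} (hij : i ≠ j) :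
    ⟪α i, α j⟫_ℝ ≤ 0 := by
  obtain ⟨x, hx⟩ := hS.exists_inner_pos
  have hr := (hS.isRoot j).map (hS.refl_mem i)
  have hj : ⟪β j, reflectionIn (α i) (α j)⟫_ℝ = 1 := by
    rw [hS.coeff_reflectionIn hij.symm, hS.dual, if_pos rfl]
  have hi : ⟪β i, reflectionIn (α i) (α j)⟫_ℝ = -2 * ⟪α i, α j⟫_ℝ := by
    rw [hS.reflectionIn_apply, inner_sub_right, inner_smul_right, hS.dual, hS.dual, if_neg hij,
      if_pos rfl]; ring
  rcases (hS.regular _ hr x hx).lt_or_gt with h | h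
  · have := hS.coeff_nonneg hr.neg hx (by rw [inner_neg_left]; linarith) j
    rw [inner_neg_right, hj] at this
    linarith
  · have := hS.coeff_nonneg hr hx h i
    rw [hi] at this
    linarith

/-! ### The exchange condition -/

theorem prod_mem (hS : IsSimpleSystem W α β) (L : List (Fin n)) :
    (L.map fun i => reflectionIn (α i)).prod ∈ W :=
  W.list_prod_mem fun g hg => by
    obtain ⟨i, -, rfl⟩ := List.mem_map.mp hg
    exact hS.refl_mem i

/-- Some letter `k` of the word turns a positive root `w α_i` negative. That root is then a multiple
of `α_k`, so `R_k = w R_i w⁻¹`, and the letter `k` cancels against the final `R_i`. -/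
theorem exchange (hS : IsSimpleSystem W α β) {x : E n} (hx : ∀ i, 0 < ⟪α i, x⟫_ℝ) (i : Fin n)
    (L : List (Fin n)) (h : ⟪(L.map fun i => reflectionIn (α i)).prod (α i), x⟫_ℝ < 0) :
    ∃ L' : List (Fin n), L'.length + 1 = L.length ∧
      (L.map fun i => reflectionIn (α i)).prod * reflectionIn (α i) =
        (L'.map fun i => reflectionIn (α i)).prod := by
  induction L with
  | nil =>
    have := hx i
    simp only [List.map_nil, List.prod_nil, LinearIsometryEquiv.coe_one, id] at h
    linarith
  | cons k L ih =>
    set w := (L.map fun i => reflectionIn (α i)).prod with hw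
    have hr : IsRoot W (w (α i)) := (hS.isRoot i).map (hS.prod_mem L)
    rw [List.map_cons, List.prod_cons, ← hw] at h ⊢
    rcases (hS.regular _ hr x hx).lt_or_gt with hlt | hgt
    · obtain ⟨L', hlen, hL'⟩ := ih hlt
      refine ⟨k :: L', by simp [hlen], ?_⟩
      simp only [List.map_cons, List.prod_cons, ← hL', mul_assoc]
    · rw [LinearIsometryEquiv.coe_mul, Function.comp_apply] at h
      have he := reflectionIn_eq_of_eq_smul hr.1 (hS.eq_smul_of_reflectionIn_neg hr hx hgt h)
      refine ⟨L, by simp, ?_⟩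
      rw [← he, reflectionIn_map]
      calc w * reflectionIn (α i) * w⁻¹ * w * reflectionIn (α i)
          = w * (reflectionIn (α i) * reflectionIn (α i)) := by group
        _ = w := by rw [reflectionIn_mul_self, mul_one]

/-- A product of simple reflections that fixes a point of the chamber is trivial. -/
theorem prod_eq_one (hS : IsSimpleSystem W α β) {x : E n} (hx : ∀ i, 0 < ⟪α i, x⟫_ℝ)
    (L : List (Fin n)) (h : (L.map fun i => reflectionIn (α i)).prod x = x) :
    (L.map fun i => reflectionIn (α i)).prod = 1 := by
  induction hk : L.length using Nat.strong_induction_on generalizing L with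
  | _ k ih =>
  rcases List.eq_nil_or_concat' L with rfl | ⟨L₀, i, rfl⟩
  · simp
  · rw [List.map_append, List.prod_append, List.map_singleton, List.prod_singleton] at h ⊢
    set w := (L₀.map fun i => reflectionIn (α i)).prod with hw
    -- Since `x = w R_i x`, this pairing equals `α_i · R_i x = -α_i · x`. Exchange then shortens the
    -- word by two letters.
    have hneg : ⟪w (α i), x⟫_ℝ < 0 := by
      rw [← h]
      change ⟪w (α i), w (reflectionIn (α i) x)⟫_ℝ < 0
      rw [LinearIsometryEquiv.inner_map_map, ← inner_reflectionIn_left, hS.reflectionIn_apply,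
        real_inner_self_eq_norm_sq, hS.unit, inner_sub_left, inner_smul_left]
      have := hx i
      simp only [conj_trivial]
      linarith
    obtain ⟨L', hlen, hL'⟩ := hS.exchange hx i L₀ hneg
    rw [hL'] at h ⊢
    refine ih L'.length ?_ L' h rfl
    rw [← hk]; simp; omega

/-! ### Irreducibility -/

/-- A subspace invariant under the simple reflections is invariant under all reflections. -/
theorem reflectionIn_invariant (hS : IsSimpleSystem W α β) (hW : Finite W) {U : Submodule ℝ (E n)}
    (hU : ∀ i, ∀ x ∈ U, reflectionIn (α i) x ∈ U) {v : E n} (hv : IsRoot W v) :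
    ∀ x ∈ U, reflectionIn v x ∈ U := by
  obtain ⟨p, hp⟩ := hS.exists_inner_pos
  by_contra hbad
  let B : Set (E n) := {w | (∃ g : W, w = (g : O n) v ∨ w = -(g : O n) v) ∧ 0 < ⟪w, p⟫_ℝ ∧
    ¬ ∀ x ∈ U, reflectionIn w x ∈ U}
  have hfin : B.Finite := by
    refine ((Set.finite_range fun g : W => (g : O n) v).union
      (Set.finite_range fun g : W => -(g : O n) v)).subset ?_
    rintro w ⟨⟨g, rfl | rfl⟩, -⟩
    · exact Or.inl ⟨g, rfl⟩
    · exact Or.inr ⟨g, rfl⟩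
  have hne : B.Nonempty := by
    rcases (hS.regular v hv p hp).lt_or_gt with h | h
    · exact ⟨-v, ⟨1, Or.inr (by simp)⟩, by rw [inner_neg_left]; linarith,
        by rwa [reflectionIn_neg]⟩
    · exact ⟨v, ⟨1, Or.inl (by simp)⟩, h, hbad⟩
  -- Descent on height: a simple reflection lowers a minimal bad positive root, giving either a
  -- lower bad root or, if the sign flips, a multiple of a simple root, which is not bad.
  obtain ⟨w, ⟨hw, hpos, hwU⟩, hmin⟩ := Set.exists_min_image B (fun w => ⟪w, p⟫_ℝ) hfin hne
  have hwr : IsRoot W w := by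
    obtain ⟨g, rfl | rfl⟩ := hw
    · exact hv.map g.2
    · exact (hv.map g.2).neg
  obtain ⟨i, hi⟩ : ∃ i, 0 < ⟪α i, w⟫_ℝ := by
    by_contra! hle
    have h1 : ⟪w, w⟫_ℝ ≤ 0 := by
      rw [hS.dual.inner_eq_sum w w]
      exact Finset.sum_nonpos fun i _ =>
        mul_nonpos_of_nonneg_of_nonpos (hS.coeff_nonneg hwr hp hpos i) (hle i)
    exact hwr.1 (inner_self_eq_zero.mp (le_antisymm h1 real_inner_self_nonneg))
  have hlt : ⟪reflectionIn (α i) w, p⟫_ℝ < ⟪w, p⟫_ℝ := by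
    rw [hS.reflectionIn_apply, inner_sub_left, inner_smul_left]
    have := mul_pos hi (hp i)
    simp only [conj_trivial]
    linarith
  have hwr' := hwr.map (hS.refl_mem i)
  rcases (hS.regular _ hwr' p hp).lt_or_gt with h | h
  · rw [reflectionIn_eq_of_eq_smul hwr.1 (hS.eq_smul_of_reflectionIn_neg hwr hp hpos h)] at hwU
    exact hwU (hU i)
  · refine absurd (hmin (reflectionIn (α i) w) ⟨?_, h, fun hall => hwU fun x hx => ?_⟩)
      (not_le.mpr hlt)
    · obtain ⟨g, rfl | rfl⟩ := hw
      · exact ⟨⟨_, hS.refl_mem i⟩ * g, Or.inl rfl⟩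
      · exact ⟨⟨_, hS.refl_mem i⟩ * g, Or.inr (map_neg _ _)⟩
    · have h3 := hU i _ (hall _ (hU i x hx))
      rw [reflectionIn_map] at h3
      have hinv : (reflectionIn (α i))⁻¹ = reflectionIn (α i) :=
        inv_eq_of_mul_eq_one_left (reflectionIn_mul_self _)
      rw [hinv] at h3
      simpa [reflectionIn_reflectionIn] using h3

theorem eq_bot_or_eq_top (hS : IsSimpleSystem W α β) (hW : IsFiniteIrreducible W)
    {U : Submodule ℝ (E n)} (hU : ∀ i, ∀ x ∈ U, reflectionIn (α i) x ∈ U) : U = ⊥ ∨ U = ⊤ := by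
  refine hW.irreducible U fun g hg => ?_
  rw [← hW.generated] at hg
  induction hg using Subgroup.closure_induction'' with
  | one => simp
  | mem g hg =>
    obtain ⟨hgW, v, hv, rfl⟩ := hg
    exact hS.reflectionIn_invariant hW.finite hU ⟨hv, hgW⟩
  | inv_mem g hg =>
    obtain ⟨hgW, v, hv, rfl⟩ := hg
    rw [inv_eq_of_mul_eq_one_left (reflectionIn_mul_self v)]
    exact hS.reflectionIn_invariant hW.finite hU ⟨hv, hgW⟩
  | mul g k _ _ ihg ihk => exact fun x hx => ihg _ (ihk x hx)

/-- The Coxeter graph is connected. -/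
theorem eq_empty_or_eq_univ (hS : IsSimpleSystem W α β) (hW : IsFiniteIrreducible W)
    {J : Set (Fin n)} (hJ : ∀ i ∈ J, ∀ j ∉ J, ⟪α j, α i⟫_ℝ = 0) : J = ∅ ∨ J = Set.univ := by
  have hinv : ∀ i, ∀ x ∈ Submodule.span ℝ (α '' J),
      reflectionIn (α i) x ∈ Submodule.span ℝ (α '' J) := by
    intro i x hx
    by_cases hi : i ∈ J
    · rw [hS.reflectionIn_apply]
      exact Submodule.sub_mem _ hx
        (Submodule.smul_mem _ _ (Submodule.subset_span ⟨i, hi, rfl⟩))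
    · have h0 : ⟪α i, x⟫_ℝ = 0 := by
        induction hx using Submodule.span_induction with
        | mem v hv => obtain ⟨j, hj, rfl⟩ := hv; exact hJ j hj i hi
        | zero => simp
        | add a b _ _ ha hb => rw [inner_add_right, ha, hb, add_zero]
        | smul c a _ ha => rw [inner_smul_right, ha, mul_zero]
      rw [hS.reflectionIn_apply, h0]
      simpa using hx
  rcases hS.eq_bot_or_eq_top hW hinv with h | h
  · left
    rw [Set.eq_empty_iff_forall_notMem]
    intro i hi
    rw [Submodule.span_eq_bot] at h
    exact (hS.isRoot i).1 (h _ ⟨i, hi, rfl⟩)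
  · right
    rw [Set.eq_univ_iff_forall]
    intro i
    by_contra hi
    have : α i ∈ Submodule.span ℝ (α '' J) := h ▸ Submodule.mem_top
    have h0 : ∀ x ∈ Submodule.span ℝ (α '' J), ⟪β i, x⟫_ℝ = 0 := by
      intro x hx
      induction hx using Submodule.span_induction with
      | mem v hv =>
        obtain ⟨j, hj, rfl⟩ := hv
        rw [hS.dual, if_neg]
        rintro rfl
        exact hi hj
      | zero => simp
      | add a b _ _ ha hb => rw [inner_add_right, ha, hb, add_zero]
      | smul c a _ ha => rw [inner_smul_right, ha, mul_zero]
    have := h0 _ this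
    rw [hS.dual, if_pos rfl] at this
    exact one_ne_zero this

end IsSimpleSystem

/-! ### A positive eigenvector of the Gram matrix -/

/-- A quadratic form `‖∑ i, x i • α i‖ ^ 2` with `α` pairwise at non-acute angles has a nonnegative
nonzero eigenvector. -/
theorem exists_nonneg_gram_eigenvector {n : ℕ} [NeZero n] (α : Fin n → E n)
    (h : ∀ i j, i ≠ j → ⟪α i, α j⟫_ℝ ≤ 0) :
    ∃ (μ : ℝ) (c : Fin n → ℝ), c ≠ 0 ∧ (∀ i, 0 ≤ c i) ∧
      ∀ i, ∑ j, ⟪α i, α j⟫_ℝ * c j = μ * c i := by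
  let A : E n →L[ℝ] E n := ∑ i, (EuclideanSpace.proj i : E n →L[ℝ] ℝ).smulRight (α i)
  have hA : ∀ x : E n, A x = ∑ i, x i • α i := fun x => by
    simp [A]
  have hA1 : ∀ i, A (EuclideanSpace.single i 1) = α i := fun i => by
    rw [hA, Finset.sum_eq_single i] <;> simp +contextual
  have hAsq : ∀ x : E n, ‖A x‖ ^ 2 = ∑ i, ∑ j, x i * x j * ⟪α i, α j⟫_ℝ := fun x => by
    rw [hA, ← real_inner_self_eq_norm_sq]
    simp only [sum_inner, inner_sum, inner_smul_left, inner_smul_right, conj_trivial, mul_assoc]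
    refine Finset.sum_congr rfl fun i _ => ?_
    rw [Finset.mul_sum]
    exact Finset.sum_congr rfl fun j _ => by rw [real_inner_comm]
  let T : E n →L[ℝ] E n := star A * A
  have hT : IsSelfAdjoint T := IsSelfAdjoint.star_mul_self A
  have hTin : ∀ x y : E n, ⟪x, T y⟫_ℝ = ⟪A x, A y⟫_ℝ := fun x y =>
    ContinuousLinearMap.adjoint_inner_right A x (A y)
  have hTq : ∀ x, T.reApplyInnerSelf x = ‖A x‖ ^ 2 := fun x => by
    rw [ContinuousLinearMap.reApplyInnerSelf_apply, real_inner_comm, hTin,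
      real_inner_self_eq_norm_sq]; rfl
  obtain ⟨x, hx, hmin⟩ := (isCompact_sphere (0 : E n) 1).exists_isMinOn
    ⟨EuclideanSpace.single 0 1, by simp⟩ T.reApplyInnerSelf_continuous.continuousOn
  have hx1 : ‖x‖ = 1 := by simpa using hx
  -- Off-diagonal Gram entries are nonpositive, so taking absolute values does not increase the
  -- form: `y` is again a minimizer on the sphere, hence an eigenvector.
  let y : E n := WithLp.toLp 2 fun i => |x i|
  have hyi : ∀ i, y i = |x i| := fun i => rfl
  have hy1 : ‖y‖ = 1 := by
    rw [← hx1, EuclideanSpace.norm_eq, EuclideanSpace.norm_eq]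
    simp [hyi]
  have hle : ‖A y‖ ^ 2 ≤ ‖A x‖ ^ 2 := by
    rw [hAsq, hAsq]
    refine Finset.sum_le_sum fun i _ => Finset.sum_le_sum fun j _ => ?_
    rw [hyi, hyi, ← abs_mul]
    by_cases hij : i = j
    · rw [hij, abs_mul_self]
    · exact mul_le_mul_of_nonpos_right (le_abs_self _) (h i j hij)
  have hy0 : y ≠ 0 := fun h0 => by rw [h0, norm_zero] at hy1; exact zero_ne_one hy1
  have hminy : IsMinOn T.reApplyInnerSelf (Metric.sphere (0 : E n) ‖y‖) y := by
    rw [hy1]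
    intro z hz
    have := hmin hz
    simp only [Set.mem_ofPred_eq, hTq] at this ⊢
    exact hle.trans this
  obtain ⟨μ, hev⟩ : ∃ μ : ℝ, T y = μ • y :=
    ⟨_, Module.End.mem_eigenspace_iff.mp (hT.hasEigenvector_of_isMinOn hy0 hminy).1⟩
  refine ⟨μ, fun i => y i, fun h0 => hy0 ?_, fun i => abs_nonneg _, fun i => ?_⟩
  · ext i; exact congrFun h0 i
  · have h1 := hTin (EuclideanSpace.single i 1) y
    rw [hev, hA1, hA, inner_smul_right, inner_sum, EuclideanSpace.inner_single_left] at h1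
    simp only [inner_smul_right, map_one, one_mul] at h1
    rw [h1]
    exact Finset.sum_congr rfl fun j _ => mul_comm _ _

theorem IsSimpleSystem.exists_pos_gram_eigenvector {n : ℕ} [NeZero n] {W : Subgroup (O n)}
    {α β : Fin n → E n} (hS : IsSimpleSystem W α β) (hW : IsFiniteIrreducible W) :
    ∃ (lam : ℝ) (c : Fin n → ℝ), (∀ i, 0 < c i) ∧
      ∀ i, ∑ j, ⟪α i, α j⟫_ℝ * c j = (1 - lam) * c i := by
  obtain ⟨μ, c, hc0, hc, hev⟩ := exists_nonneg_gram_eigenvector α fun i j => hS.inner_nonpos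
  refine ⟨1 - μ, c, ?_, by simpa using hev⟩
  -- Where `c j = 0`, the eigenvector equation is a vanishing sum of nonpositive terms.
  have hJ : ∀ i ∈ {i | c i ≠ 0}, ∀ j ∉ {i | c i ≠ 0}, ⟪α j, α i⟫_ℝ = 0 := by
    intro i hi j hj
    have hj0 : c j = 0 := by simpa using hj
    have h1 := hev j
    rw [hj0, mul_zero, Finset.sum_eq_zero_iff_of_nonpos] at h1
    · exact (mul_eq_zero.mp (h1 i (Finset.mem_univ i))).resolve_right hi
    · intro k _
      by_cases hk : j = k
      · rw [← hk, hj0, mul_zero]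
      · exact mul_nonpos_of_nonpos_of_nonneg (hS.inner_nonpos hk) (hc k)
  rcases hS.eq_empty_or_eq_univ hW hJ with h | h
  · exact absurd (funext fun i => by simpa using Set.eq_empty_iff_forall_notMem.mp h i) hc0
  · exact fun i => lt_of_le_of_ne (hc i) (Ne.symm (Set.eq_univ_iff_forall.mp h i))

/-! ### Prefixes of the Coxeter word -/

section Prefix

variable {n : ℕ} [NeZero n] (α : Fin n → E n)

theorem cyc_add_mul (v : Fin n → E n) {i : ℕ} (hi : 1 ≤ i) (q : ℕ) :
    cyc v (q * n + i) = cyc v i := by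
  unfold cyc
  congr 1
  ext
  rw [Fin.val_ofNat, Fin.val_ofNat, Nat.add_sub_assoc hi, Nat.add_comm, Nat.add_mul_mod_self_right]

theorem cyc_val_succ (v : Fin n → E n) (i : Fin n) : cyc v (i + 1) = v i := by
  unfold cyc
  congr 1
  ext
  simp

theorem prefixProd_zero : prefixProd α 0 = 1 := rfl

theorem prefixProd_succ (k : ℕ) :
    prefixProd α (k + 1) = prefixProd α k * reflectionIn (cyc α (k + 1)) := by
  simp [prefixProd, List.range_succ]

theorem prefixProd_add_period (k : ℕ) :
    prefixProd α (k + n) = prefixProd α n * prefixProd α k := by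
  induction k with
  | zero => simp [prefixProd_zero]
  | succ k ih =>
    rw [Nat.add_right_comm, prefixProd_succ, ih, prefixProd_succ, mul_assoc]
    congr 3
    have := cyc_add_mul α (i := k + 1) (by omega) 1
    rwa [one_mul, show n + (k + 1) = k + n + 1 by omega] at this

theorem prefixProd_mul_add (q k : ℕ) :
    prefixProd α (q * n + k) = prefixProd α n ^ q * prefixProd α k := by
  induction q with
  | zero => simp
  | succ q ih =>
    rw [show (q + 1) * n + k = q * n + k + n by ring, prefixProd_add_period, ih, pow_succ',
      mul_assoc]

theorem prefixProd_self : prefixProd α n = coxeterElement α := by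
  unfold prefixProd coxeterElement
  congr 1
  refine List.ext_getElem (by simp) fun k h1 h2 => ?_
  have hk : k < n := by simpa using h1
  simp only [List.getElem_map, List.getElem_range, List.getElem_ofFn]
  exact congrArg reflectionIn (cyc_val_succ α ⟨k, hk⟩)

theorem prefixProd_eq_prod (k : ℕ) :
    prefixProd α k =
      (((List.range k).map fun m => Fin.ofNat n m).map fun i => reflectionIn (α i)).prod := by
  rw [List.map_map]; rfl

theorem coxeterElement_pow_eq_prod (q : ℕ) : ∃ L : List (Fin n),
    coxeterElement α ^ q = (L.map fun i => reflectionIn (α i)).prod := by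
  refine ⟨_, .trans ?_ (prefixProd_eq_prod α (q * n))⟩
  rw [← add_zero (q * n), prefixProd_mul_add, prefixProd_self, prefixProd_zero, mul_one]

end Prefix

/-! ### Products of mutually orthogonal reflections -/

section Block

variable {n : ℕ} (α : Fin n → E n)

/-- The map `x ↦ x - ∑ i ∈ J, 2 ⟪α i, x⟫ α i`, the product of the reflections in `α i`, `i ∈ J`, if
these are orthonormal. -/
def blockReflection (J : Finset (Fin n)) : E n →ₗ[ℝ] E n :=
  LinearMap.id - ∑ i ∈ J, (2 : ℝ) • (innerₛₗ ℝ (α i)).smulRight (α i)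

variable {α}

theorem blockReflection_apply (J : Finset (Fin n)) (x : E n) :
    blockReflection α J x = x - ∑ i ∈ J, (2 * ⟪α i, x⟫_ℝ) • α i := by
  simp [blockReflection, LinearMap.sum_apply, smul_smul]

theorem trace_blockReflection (hu : ∀ i, ‖α i‖ = 1) (J : Finset (Fin n)) :
    LinearMap.trace ℝ (E n) (blockReflection α J) = n - 2 * J.card := by
  simp [blockReflection, hu, mul_comm]

theorem inner_blockReflection (J : Finset (Fin n)) (v x : E n) :
    ⟪v, blockReflection α J x⟫_ℝ = ⟪v, x⟫_ℝ - ∑ i ∈ J, 2 * ⟪α i, x⟫_ℝ * ⟪v, α i⟫_ℝ := by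
  simp [blockReflection_apply, inner_sub_right, inner_sum, inner_smul_right]

theorem inner_blockReflection_mem (hu : ∀ i, ‖α i‖ = 1) {J : Finset (Fin n)}
    (hJ : ∀ i ∈ J, ∀ j ∈ J, i ≠ j → ⟪α i, α j⟫_ℝ = 0) {i : Fin n} (hi : i ∈ J) (x : E n) :
    ⟪α i, blockReflection α J x⟫_ℝ = -⟪α i, x⟫_ℝ := by
  rw [inner_blockReflection, Finset.sum_eq_single i, real_inner_self_eq_norm_sq, hu]
  · ring
  · intro j hj hji
    rw [hJ i hi j hj hji.symm, mul_zero]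
  · exact fun h => absurd hi h

theorem blockReflection_blockReflection (hu : ∀ i, ‖α i‖ = 1) {J : Finset (Fin n)}
    (hJ : ∀ i ∈ J, ∀ j ∈ J, i ≠ j → ⟪α i, α j⟫_ℝ = 0) (x : E n) :
    blockReflection α J (blockReflection α J x) = x := by
  rw [blockReflection_apply, Finset.sum_congr rfl fun i hi => by
    rw [inner_blockReflection_mem hu hJ hi], blockReflection_apply]
  simp

theorem blockReflection_of_orthogonal {J : Finset (Fin n)} {x : E n}
    (hx : ∀ i ∈ J, ⟪α i, x⟫_ℝ = 0) : blockReflection α J x = x := by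
  rw [blockReflection_apply, Finset.sum_eq_zero fun i hi => by rw [hx i hi]; simp, sub_zero]

end Block

theorem prefixProd_eq_blockReflection {n : ℕ} [NeZero n] {α : Fin n → E n}
    (hu : ∀ i, ‖α i‖ = 1) {t r : ℕ} (htr : t ≤ r) (hr : r ≤ n)
    (hO : ∀ i j : Fin n, t ≤ i → i < r → t ≤ j → j < r → i ≠ j → ⟪α i, α j⟫_ℝ = 0) (x : E n) :
    prefixProd α r x = prefixProd α t
      (blockReflection α (Finset.univ.filter fun i : Fin n => t ≤ i ∧ (i : ℕ) < r) x) := by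
  induction r, htr using Nat.le_induction generalizing x with
  | base =>
    congr 1
    rw [blockReflection_apply, Finset.filter_false_of_mem fun i _ => by omega]
    simp
  | succ r htr ih =>
    have hrn : r < n := by omega
    rw [prefixProd_succ, LinearIsometryEquiv.coe_mul, Function.comp_apply,
      ih (by omega) fun i j h1 h2 h3 h4 => hO i j h1 (by omega) h3 (by omega)]
    congr 1
    have hcyc : cyc α (r + 1) = α ⟨r, hrn⟩ := cyc_val_succ α ⟨r, hrn⟩
    have hins : (Finset.univ.filter fun i : Fin n => t ≤ i ∧ (i : ℕ) < r + 1) =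
        insert ⟨r, hrn⟩ (Finset.univ.filter fun i : Fin n => t ≤ i ∧ (i : ℕ) < r) := by
      ext i
      simp only [Finset.mem_filter, Finset.mem_univ, true_and, Finset.mem_insert, Fin.ext_iff]
      omega
    rw [hcyc, hins, reflectionIn_apply_of_unit (hu _), map_sub, map_smul,
      blockReflection_of_orthogonal (x := α ⟨r, hrn⟩), blockReflection_apply, blockReflection_apply,
      Finset.sum_insert (by simp)]
    · abel
    · intro i hi
      simp only [Finset.mem_filter, Finset.mem_univ, true_and] at hi
      exact hO _ _ hi.1 (by omega) htr (by simp) (by simp [Fin.ext_iff]; omega)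

/-! ### Dynamics of the Coxeter element on the Coxeter plane -/

/-- Unit vectors `α` with dual basis `β`, split at the index `s` into two orthonormal sets, and an
eigenvector `c` of their Gram matrix with positive coordinates. -/
structure BipartiteSystem {n : ℕ} (α β : Fin n → E n) (s : ℕ) (lam : ℝ) (c : Fin n → ℝ) :
    Prop where
  le : s ≤ n
  unit : ∀ i, ‖α i‖ = 1
  dual : IsDualBasis α β
  orth_left : ∀ i j : Fin n, (i : ℕ) < s → (j : ℕ) < s → i ≠ j → ⟪α i, α j⟫_ℝ = 0
  orth_right : ∀ i j : Fin n, s ≤ (i : ℕ) → s ≤ (j : ℕ) → i ≠ j → ⟪α i, α j⟫_ℝ = 0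
  pos : ∀ i, 0 < c i
  eigen : ∀ i, ∑ j, ⟪α i, α j⟫_ℝ * c j = (1 - lam) * c i

/-- The inner product of `x` with `α i` is `c i * f` for `i` in the first block and `c i * g` for
`i` in the second one. -/
def HasType {n : ℕ} (α : Fin n → E n) (s : ℕ) (c : Fin n → ℝ) (x : E n) (f g : ℝ) : Prop :=
  ∀ i : Fin n, ⟪α i, x⟫_ℝ = c i * if (i : ℕ) < s then f else g

/-- The indices in `[t, r)`. -/
abbrev indexBlock (n t r : ℕ) : Finset (Fin n) :=
  Finset.univ.filter fun i : Fin n => t ≤ i ∧ (i : ℕ) < r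

/-- The sequence `sin (k θ) / sin θ` for `lam = cos θ`. -/
def sineSeq (lam : ℝ) : ℕ → ℝ
  | 0 => 0
  | 1 => 1
  | k + 2 => 2 * lam * sineSeq lam (k + 1) - sineSeq lam k

theorem sineSeq_add_two (lam : ℝ) (k : ℕ) :
    sineSeq lam (k + 2) = 2 * lam * sineSeq lam (k + 1) - sineSeq lam k := rfl

theorem sineSeq_invariant (lam : ℝ) (k : ℕ) :
    sineSeq lam (k + 1) ^ 2 - 2 * lam * sineSeq lam (k + 1) * sineSeq lam k
      + sineSeq lam k ^ 2 = 1 := by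
  induction k with
  | zero => simp [sineSeq]
  | succ k ih =>
    rw [sineSeq_add_two]
    linear_combination ih

/-- If the sequence first becomes nonpositive with a zero at `K`, then it is antiperiodic. -/
theorem sineSeq_add_of_eq_zero {lam : ℝ} {K : ℕ} (h0 : sineSeq lam (K + 1) = 0)
    (h1 : 0 < sineSeq lam K) (m : ℕ) : sineSeq lam (K + 1 + m) = -sineSeq lam m := by
  have hK : sineSeq lam K = 1 := by
    have := sineSeq_invariant lam K
    rw [h0] at this
    nlinarith
  induction m using Nat.strong_induction_on with
  | _ m ih =>
    match m with
    | 0 => simpa [sineSeq] using h0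
    | 1 => rw [sineSeq_add_two, h0, hK]; simp [sineSeq]
    | m + 2 =>
      rw [← Nat.add_assoc, sineSeq_add_two, sineSeq_add_two, Nat.add_assoc (K + 1) m 1,
        ih (m + 1) (by omega), ih m (by omega)]
      ring

namespace BipartiteSystem

variable {n : ℕ} {α β : Fin n → E n} {s : ℕ} {lam : ℝ} {c : Fin n → ℝ}

theorem exists_hasType (hB : BipartiteSystem α β s lam c) (f g : ℝ) :
    ∃ x, HasType α s c x f g :=
  hB.dual.exists_inner_eq _

theorem eq_of_hasType (hB : BipartiteSystem α β s lam c) {x y : E n} {f g : ℝ}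
    (hx : HasType α s c x f g) (hy : HasType α s c y f g) : x = y :=
  hB.dual.ext_left fun i => (hx i).trans (hy i).symm

/-- Outside `J` only the diagonal entry `1` survives, and it cancels the `1` in the eigenvalue `1 -
lam`. -/
theorem sum_gram (hB : BipartiteSystem α β s lam c) {J : Finset (Fin n)} {i : Fin n} (hi : i ∉ J)
    (hO : ∀ j ∉ J, i ≠ j → ⟪α i, α j⟫_ℝ = 0) :
    ∑ j ∈ J, ⟪α i, α j⟫_ℝ * c j = -lam * c i := by
  have h1 := hB.eigen i
  rw [← Finset.sum_add_sum_compl J, Finset.sum_eq_single i (s := Jᶜ), real_inner_self_eq_norm_sq,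
    hB.unit] at h1
  · linarith
  · intro j hj hji
    rw [hO j (Finset.mem_compl.mp hj) hji.symm, zero_mul]
  · exact fun h => absurd (Finset.mem_compl.mpr hi) h

theorem inner_blockReflection_notMem (hB : BipartiteSystem α β s lam c) {J : Finset (Fin n)}
    {i : Fin n} (hi : i ∉ J) (hO : ∀ j ∉ J, i ≠ j → ⟪α i, α j⟫_ℝ = 0) {x : E n} {f : ℝ}
    (hx : ∀ j ∈ J, ⟪α j, x⟫_ℝ = c j * f) :
    ⟪α i, blockReflection α J x⟫_ℝ = ⟪α i, x⟫_ℝ + c i * (2 * lam * f) := by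
  have h1 : ∑ j ∈ J, 2 * ⟪α j, x⟫_ℝ * ⟪α i, α j⟫_ℝ =
      2 * f * ∑ j ∈ J, ⟪α i, α j⟫_ℝ * c j := by
    rw [Finset.mul_sum]
    exact Finset.sum_congr rfl fun j hj => by rw [hx j hj]; ring
  rw [inner_blockReflection, h1, hB.sum_gram hi hO]
  ring

theorem orth_indexBlock_left (hB : BipartiteSystem α β s lam c) :
    ∀ i ∈ indexBlock n 0 s, ∀ j ∈ indexBlock n 0 s, i ≠ j → ⟪α i, α j⟫_ℝ = 0 := by
  intro i hi j hj
  simp only [Finset.mem_filter, Finset.mem_univ, true_and] at hi hj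
  exact hB.orth_left i j hi.2 hj.2

theorem orth_indexBlock_right (hB : BipartiteSystem α β s lam c) :
    ∀ i ∈ indexBlock n s n, ∀ j ∈ indexBlock n s n, i ≠ j → ⟪α i, α j⟫_ℝ = 0 := by
  intro i hi j hj
  simp only [Finset.mem_filter, Finset.mem_univ, true_and] at hi hj
  exact hB.orth_right i j hi.1 hj.1

theorem hasType_blockReflection_left (hB : BipartiteSystem α β s lam c) {x : E n} {f g : ℝ}
    (hx : HasType α s c x f g) :
    HasType α s c (blockReflection α (indexBlock n 0 s) x) (-f) (g + 2 * lam * f) := by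
  intro i
  by_cases hi : (i : ℕ) < s
  · rw [inner_blockReflection_mem hB.unit hB.orth_indexBlock_left (by simpa using hi), hx i,
      if_pos hi, if_pos hi]
    ring
  · rw [hB.inner_blockReflection_notMem (f := f) (by simpa using hi), hx i, if_neg hi, if_neg hi]
    · ring
    · exact fun j hj => hB.orth_right i j (by omega) (by simpa using hj)
    · intro j hj
      rw [hx j, if_pos (by simpa using hj)]

theorem hasType_blockReflection_right (hB : BipartiteSystem α β s lam c) {x : E n} {f g : ℝ}
    (hx : HasType α s c x f g) :
    HasType α s c (blockReflection α (indexBlock n s n) x) (f + 2 * lam * g) (-g) := by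
  intro i
  by_cases hi : (i : ℕ) < s
  · rw [hB.inner_blockReflection_notMem (f := g) (by simpa using hi), hx i, if_pos hi, if_pos hi]
    · ring
    · exact fun j hj => hB.orth_left i j hi (by simpa using hj)
    · intro j hj
      rw [hx j, if_neg (by simpa using hj)]
  · rw [inner_blockReflection_mem hB.unit hB.orth_indexBlock_right (by simpa using hi), hx i,
      if_neg hi, if_neg hi]
    ring

variable [NeZero n]

theorem prefixProd_left (hB : BipartiteSystem α β s lam c) (x : E n) :
    prefixProd α s x = blockReflection α (indexBlock n 0 s) x := by
  rw [prefixProd_eq_blockReflection hB.unit (Nat.zero_le s) hB.le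
    fun i j _ hi _ hj => hB.orth_left i j hi hj]
  rfl

theorem coxeterElement_apply (hB : BipartiteSystem α β s lam c) (x : E n) :
    coxeterElement α x =
      blockReflection α (indexBlock n 0 s) (blockReflection α (indexBlock n s n) x) := by
  rw [← prefixProd_self, prefixProd_eq_blockReflection hB.unit hB.le le_rfl
    fun i j hi _ hj _ => hB.orth_right i j hi hj, hB.prefixProd_left]

theorem hasType_prefixProd_inv (hB : BipartiteSystem α β s lam c) {x : E n} {f g : ℝ}
    (hx : HasType α s c x f g) :
    HasType α s c ((prefixProd α s)⁻¹ x) (-f) (g + 2 * lam * f) := by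
  -- The expected preimage, checked by applying the forward map; a vector is determined by its type.
  obtain ⟨z, hz⟩ := hB.exists_hasType (-f) (g + 2 * lam * f)
  have h1 : prefixProd α s z = x := by
    rw [hB.prefixProd_left]
    refine hB.eq_of_hasType (hB.hasType_blockReflection_left hz) ?_
    convert hx using 1 <;> ring
  rw [← h1]
  convert hz
  exact (prefixProd α s).symm_apply_apply z

theorem hasType_coxeterElement_inv (hB : BipartiteSystem α β s lam c) {x : E n} {f g : ℝ}
    (hx : HasType α s c x f g) :
    HasType α s c ((coxeterElement α)⁻¹ x) (-f + 2 * lam * (g + 2 * lam * f))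
      (-(g + 2 * lam * f)) := by
  obtain ⟨z, hz⟩ := hB.exists_hasType (-f + 2 * lam * (g + 2 * lam * f)) (-(g + 2 * lam * f))
  have h1 : coxeterElement α z = x := by
    rw [hB.coxeterElement_apply]
    refine hB.eq_of_hasType
      (hB.hasType_blockReflection_left (hB.hasType_blockReflection_right hz)) ?_
    convert hx using 1 <;> ring
  rw [← h1]
  convert hz
  exact (coxeterElement α).symm_apply_apply z

/-- The factor `2 * lam * sineSeq lam (2 * q) - sineSeq lam (2 * q + 1)` is the term of index `2q -
1`, written so that `q = 0` is covered. -/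
theorem hasType_coxeterElement_pow_inv (hB : BipartiteSystem α β s lam c) {x : E n} {f g : ℝ}
    (hx : HasType α s c x f g) (q : ℕ) :
    HasType α s c ((coxeterElement α ^ q)⁻¹ x)
      (f * sineSeq lam (2 * q + 1) + g * sineSeq lam (2 * q))
      (-(f * sineSeq lam (2 * q) +
        g * (2 * lam * sineSeq lam (2 * q) - sineSeq lam (2 * q + 1)))) := by
  induction q with
  | zero => simpa [sineSeq] using hx
  | succ q ih =>
    have h1 := hB.hasType_coxeterElement_inv ih
    have h2 : (coxeterElement α ^ (q + 1))⁻¹ x =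
        (coxeterElement α)⁻¹ ((coxeterElement α ^ q)⁻¹ x) := by
      rw [pow_succ, mul_inv_rev, LinearIsometryEquiv.coe_mul, Function.comp_apply]
    rw [h2]
    convert h1 using 1
    · rw [show 2 * (q + 1) + 1 = 2 * q + 1 + 2 by ring, show 2 * (q + 1) = 2 * q + 2 by ring,
        sineSeq_add_two, show 2 * q + 1 + 1 = 2 * q + 2 by ring, sineSeq_add_two]
      ring
    · rw [show 2 * (q + 1) + 1 = 2 * q + 1 + 2 by ring, show 2 * (q + 1) = 2 * q + 2 by ring,
        sineSeq_add_two _ (2 * q + 1), show 2 * q + 1 + 1 = 2 * q + 2 by ring, sineSeq_add_two]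
      ring

theorem rho_left (hB : BipartiteSystem α β s lam c) (q : ℕ) {r : Fin n} (hr : (r : ℕ) < s) :
    rho α (q * n + r + 1) = (coxeterElement α ^ q) (α r) := by
  have hc : cyc α (q * n + r + 1) = α r := by
    rw [Nat.add_assoc, cyc_add_mul α (by omega), cyc_val_succ]
  rw [rho, hc, Nat.add_sub_cancel, prefixProd_mul_add, prefixProd_self,
    LinearIsometryEquiv.coe_mul, Function.comp_apply,
    prefixProd_eq_blockReflection hB.unit (Nat.zero_le _) r.2.le
      fun i j _ hi _ hj => hB.orth_left i j (by omega) (by omega),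
    blockReflection_of_orthogonal, prefixProd_zero]
  · rfl
  · intro i hi
    simp only [Finset.mem_filter, Finset.mem_univ, true_and] at hi
    exact hB.orth_left i r (by omega) hr (by rintro rfl; omega)

theorem rho_right (hB : BipartiteSystem α β s lam c) (q : ℕ) {r : Fin n} (hr : s ≤ (r : ℕ)) :
    rho α (q * n + r + 1) = (coxeterElement α ^ q) (prefixProd α s (α r)) := by
  have hc : cyc α (q * n + r + 1) = α r := by
    rw [Nat.add_assoc, cyc_add_mul α (by omega), cyc_val_succ]
  rw [rho, hc, Nat.add_sub_cancel, prefixProd_mul_add, prefixProd_self,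
    LinearIsometryEquiv.coe_mul, Function.comp_apply,
    prefixProd_eq_blockReflection hB.unit hr r.2.le
      fun i j hi _ hj _ => hB.orth_right i j hi hj,
    blockReflection_of_orthogonal]
  intro i hi
  simp only [Finset.mem_filter, Finset.mem_univ, true_and] at hi
  exact hB.orth_right i r (by omega) hr (by rintro rfl; omega)

theorem inner_rho (hB : BipartiteSystem α β s lam c) {x : E n} {f g : ℝ}
    (hx : HasType α s c x f g) (q : ℕ) (r : Fin n) {k : ℕ}
    (hk : k = 2 * q + if (r : ℕ) < s then 0 else 1) :
    ⟪rho α (q * n + r + 1), x⟫_ℝ = c r * (f * sineSeq lam (k + 1) + g * sineSeq lam k) := by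
  have hq := hB.hasType_coxeterElement_pow_inv hx q
  by_cases hr : (r : ℕ) < s
  · rw [if_pos hr] at hk
    rw [hB.rho_left q hr, inner_map_left, hq r, if_pos hr, hk, add_zero]
  · rw [if_neg hr] at hk
    rw [hB.rho_right q (not_lt.mp hr), inner_map_left, inner_map_left,
      hB.hasType_prefixProd_inv hq r, if_neg hr, hk, sineSeq_add_two]
    ring

/-- For odd order of the Coxeter element the two blocks have the same size. -/
theorem two_mul_eq_of_odd (hB : BipartiteSystem α β s lam c) {m : ℕ}
    (hm : coxeterElement α ^ (2 * m + 1) = 1) : 2 * s = n := by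
  set a := blockReflection α (indexBlock n 0 s) with ha
  set b := blockReflection α (indexBlock n s n) with hb
  have haa : ∀ x, a (a x) = x := blockReflection_blockReflection hB.unit hB.orth_indexBlock_left
  have hbb : ∀ x, b (b x) = x := blockReflection_blockReflection hB.unit hB.orth_indexBlock_right
  set γ := coxeterElement α with hγ
  have hγx : ∀ x, γ x = a (b x) := hB.coxeterElement_apply
  have hsucc : ∀ k x, (γ ^ (k + 1)) x = (γ ^ k) (γ x) := fun k x => by
    rw [pow_succ, LinearIsometryEquiv.coe_mul, Function.comp_apply]
  have hswap : ∀ k x, (γ ^ k) (a ((γ ^ k) x)) = a x := by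
    intro k
    induction k with
    | zero => intro x; simp
    | succ k ih =>
      intro x
      rw [hsucc k x, pow_succ', LinearIsometryEquiv.coe_mul, Function.comp_apply, ih, hγx, hγx, haa,
        hbb]
  have hconj : ∀ x, (γ ^ m).toLinearEquiv.conj a x = b x := by
    intro x
    obtain ⟨z, rfl⟩ := (γ ^ m).surjective x
    have h1 : (γ ^ m) (γ ((γ ^ m) z)) = z := by
      have : (γ ^ (m + (1 + m))) z = z := by rw [show m + (1 + m) = 2 * m + 1 by ring, hm]; rfl
      rwa [pow_add, pow_add, pow_one] at this
    have h2 := hswap m (γ ((γ ^ m) z))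
    rw [h1, hγx, haa] at h2
    rw [LinearEquiv.conj_apply_apply]
    exact (congrArg (fun y => (γ ^ m) (a y)) ((γ ^ m).symm_apply_apply z)).trans h2
  have htr := LinearMap.trace_conj' a (γ ^ m).toLinearEquiv
  rw [LinearMap.ext hconj, ha, hb, trace_blockReflection hB.unit,
    trace_blockReflection hB.unit] at htr
  have h1 := Finset.card_filter_add_card_filter_not (s := (Finset.univ : Finset (Fin n)))
      fun i : Fin n => (i : ℕ) < s
  have e1 : indexBlock n 0 s = Finset.univ.filter fun i : Fin n => (i : ℕ) < s := by
    ext i; simp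
  have e2 : indexBlock n s n = Finset.univ.filter fun i : Fin n => ¬ (i : ℕ) < s := by
    ext i; simp
  rw [← e1, ← e2, Finset.card_univ, Fintype.card_fin] at h1
  have h2 : (indexBlock n 0 s).card = s := by
    rw [e1, Fin.card_filter_val_lt, min_eq_right hB.le]
  have : ((indexBlock n 0 s).card : ℝ) = (indexBlock n s n).card := by linarith
  have := Nat.cast_injective (R := ℝ) this
  omega

end BipartiteSystem

/-! ### Positivity of the roots `ρ` -/

section Positivity

variable {n : ℕ} [NeZero n] {W : Subgroup (O n)} {α β : Fin n → E n} {s : ℕ} {lam : ℝ}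
  {c : Fin n → ℝ}

theorem IsSimpleSystem.prefixProd_mem (hS : IsSimpleSystem W α β) (k : ℕ) :
    prefixProd α k ∈ W := by
  rw [prefixProd_eq_prod]
  exact hS.prod_mem _

theorem IsSimpleSystem.isRoot_rho (hS : IsSimpleSystem W α β) (j : ℕ) : IsRoot W (rho α j) :=
  (hS.isRoot _).map (hS.prefixProd_mem _)

namespace BipartiteSystem

theorem not_sineSeq_sign_change (hB : BipartiteSystem α β s lam c) (hS : IsSimpleSystem W α β)
    (q : ℕ) (r : Fin n) {k : ℕ} (hk : k = 2 * q + if (r : ℕ) < s then 0 else 1)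
    (h0 : 0 < sineSeq lam k) : 0 ≤ sineSeq lam (k + 1) := by
  by_contra! h1
  -- After a strict sign change this point is in the chamber, yet the root pairs with it to zero.
  obtain ⟨x, hx⟩ := hB.exists_hasType (sineSeq lam k) (-sineSeq lam (k + 1))
  refine hS.regular _ (hS.isRoot_rho (q * n + r + 1)) x (fun i => ?_) ?_
  · rw [hx i]
    refine mul_pos (hB.pos i) ?_
    split_ifs <;> linarith
  · rw [hB.inner_rho hx q r hk]
    ring

/-- If `lam ≠ 0` then both blocks are nonempty. -/
theorem exists_index (hB : BipartiteSystem α β s lam c) (hlam : lam ≠ 0) :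
    (∃ i : Fin n, (i : ℕ) < s) ∧ ∃ i : Fin n, ¬ (i : ℕ) < s := by
  by_contra hne
  have hO : ∀ j : Fin n, 0 ≠ j → ⟪α 0, α j⟫_ℝ = 0 := by
    rcases not_and_or.mp hne with h | h <;> push Not at h
    · exact fun j => hB.orth_right 0 j (h 0) (h j)
    · exact fun j => hB.orth_left 0 j (h 0) (h j)
  have h1 := hB.sum_gram (J := ∅) (i := 0) (by simp) fun j _ => hO j
  rw [Finset.sum_empty] at h1
  exact mul_ne_zero (neg_ne_zero.mpr hlam) (hB.pos 0).ne' h1.symm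

theorem exists_sineSeq_eq_zero (hB : BipartiteSystem α β s lam c) (hS : IsSimpleSystem W α β)
    {h : ℕ} (hh : 0 < h) (hγ : coxeterElement α ^ h = 1) :
    ∃ K, sineSeq lam (K + 1) = 0 ∧ ∀ k, 1 ≤ k → k ≤ K → 0 < sineSeq lam k := by
  have hex : ∃ K, sineSeq lam (K + 1) ≤ 0 := by
    by_cases hlam : lam = 0
    · exact ⟨1, by simp [sineSeq, hlam]⟩
    · obtain ⟨i, hi⟩ := (hB.exists_index hlam).1
      obtain ⟨x, hx⟩ := hB.exists_hasType 0 1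
      have h1 := hB.hasType_coxeterElement_pow_inv hx h i
      -- On type `(0, 1)`, the first coordinate of `γ^h = 1` reads `sineSeq lam (2h) = 0`.
      rw [hγ, inv_one, LinearIsometryEquiv.coe_one, id, hx i, if_pos hi, if_pos hi, mul_zero,
        zero_mul, one_mul, zero_add] at h1
      refine ⟨2 * h - 1, ?_⟩
      rw [Nat.sub_add_cancel (by omega)]
      exact ((mul_eq_zero.mp h1.symm).resolve_left (hB.pos i).ne').le
  classical
  have hmin : ∀ k, 1 ≤ k → k ≤ Nat.find hex → 0 < sineSeq lam k := fun k h1 h2 => by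
    have := Nat.find_min hex (m := k - 1) (by omega)
    rwa [Nat.sub_add_cancel h1, not_le] at this
  refine ⟨Nat.find hex, le_antisymm (Nat.find_spec hex) ?_, hmin⟩
  rcases Nat.eq_zero_or_pos (Nat.find hex) with h0 | h0
  · rw [h0]; simp [sineSeq]
  · by_cases hlam : lam = 0
    · have h1 : Nat.find hex = 1 :=
        le_antisymm (Nat.find_min' hex (by simp [sineSeq, hlam])) h0
      rw [h1]; simp [sineSeq, hlam]
    · obtain ⟨⟨i, hi⟩, j, hj⟩ := hB.exists_index hlam
      -- Parity decides which block supplies the root, so both must be nonempty.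
      rcases Nat.even_or_odd' (Nat.find hex) with ⟨q, hq | hq⟩
      · exact hB.not_sineSeq_sign_change hS q i (by rw [if_pos hi, hq, add_zero])
          (hmin _ h0 le_rfl)
      · exact hB.not_sineSeq_sign_change hS q j (by rw [if_neg hj, hq]) (hmin _ h0 le_rfl)

theorem sineSeq_pos (hB : BipartiteSystem α β s lam c) (hS : IsSimpleSystem W α β)
    (hfin : 0 < orderOf (coxeterElement α)) {k : ℕ} (hk : k < orderOf (coxeterElement α)) :
    0 < sineSeq lam (k + 1) + sineSeq lam k := by
  obtain ⟨K, hK, hpos⟩ := hB.exists_sineSeq_eq_zero hS hfin (pow_orderOf_eq_one _)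
  have hKpos : 0 < K := by
    rcases Nat.eq_zero_or_pos K with rfl | h
    · simp [sineSeq] at hK
    · exact h
  have hanti := sineSeq_add_of_eq_zero hK (hpos K hKpos le_rfl)
  have hle : orderOf (coxeterElement α) ≤ K + 1 := by
    refine orderOf_le_of_pow_eq_one K.succ_pos ?_
    obtain ⟨x, hx⟩ := hB.exists_hasType 1 1
    have h0 : sineSeq lam (2 * (K + 1)) = 0 := by rw [two_mul, hanti, hK, neg_zero]
    have h1 : sineSeq lam (2 * (K + 1) + 1) = 1 := by
      rw [two_mul, Nat.add_assoc, hanti, hanti]; simp [sineSeq]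
    have hxfix : (coxeterElement α ^ (K + 1))⁻¹ x = x := by
      refine hB.eq_of_hasType (hB.hasType_coxeterElement_pow_inv hx (K + 1)) ?_
      rw [h0, h1]
      simpa using hx
    have hxfix' : (coxeterElement α ^ (K + 1)) x = x := by
      conv_lhs => rw [← hxfix]
      exact (coxeterElement α ^ (K + 1)).apply_symm_apply x
    obtain ⟨L, hL⟩ := coxeterElement_pow_eq_prod α (K + 1)
    rw [hL]
    rw [hL] at hxfix'
    refine hS.prod_eq_one (fun i => ?_) L hxfix'
    rw [hx i, ite_self, mul_one]
    exact hB.pos i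
  have hnn : 0 ≤ sineSeq lam (k + 1) := by
    rcases Nat.lt_or_ge k K with h | h
    · exact (hpos _ (by omega) h).le
    · rw [show k = K by omega, hK]
  rcases Nat.eq_zero_or_pos k with rfl | h
  · simp [sineSeq]
  · have := hpos k h (by omega)
    linarith

/-- The roots `ρ j` with `j ≤ n h / 2` are positive. -/
theorem coeff_rho_nonneg (hB : BipartiteSystem α β s lam c) (hS : IsSimpleSystem W α β)
    {j : ℕ} (hj1 : 1 ≤ j) (hj : j ≤ n * orderOf (coxeterElement α) / 2) (i : Fin n) :
    0 ≤ ⟪β i, rho α j⟫_ℝ := by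
  set h := orderOf (coxeterElement α) with hh
  have hn : 0 < n := Nat.pos_of_neZero n
  have hj2 : 2 * j ≤ n * h := by omega
  have hfin : 0 < h := by
    rcases Nat.eq_zero_or_pos h with h0 | h0
    · rw [h0] at hj2; omega
    · exact h0
  obtain ⟨q, r, rfl⟩ : ∃ (q : ℕ) (r : Fin n), j = q * n + r + 1 :=
    ⟨(j - 1) / n, ⟨(j - 1) % n, Nat.mod_lt _ hn⟩, by
      have := Nat.div_add_mod' (j - 1) n
      simp only; omega⟩
  -- For `h = 2m` the bound on `j` gives `q < m`. For `h = 2m + 1` it allows `q = m`, but then `r <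
  -- n/2 = s`.
  have hk : (2 * q + if (r : ℕ) < s then 0 else 1) < h := by
    rcases Nat.even_or_odd' h with ⟨m, hm | hm⟩
    · have hq : q < m := by
        by_contra! hle
        have := Nat.mul_le_mul_right n hle
        have e : n * h = 2 * (m * n) := by rw [hm]; ring
        omega
      split_ifs <;> omega
    · have hs : 2 * s = n := hB.two_mul_eq_of_odd (m := m) (by rw [← hm]; exact pow_orderOf_eq_one _)
      have e : n * h = 2 * (m * n) + n := by rw [hm]; ring
      have hq : q < m ∨ q = m := by
        by_contra! hne
        have := Nat.mul_le_mul_right n (show m + 1 ≤ q by omega)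
        rw [Nat.add_mul] at this
        omega
      rcases hq with hq | rfl
      · split_ifs <;> omega
      · rw [if_pos (by omega)]; omega
  obtain ⟨x, hx⟩ := hB.exists_hasType 1 1
  refine hS.coeff_nonneg (hS.isRoot_rho _) (x := x) (fun i => ?_) ?_ i
  · rw [hx i, ite_self, mul_one]
    exact hB.pos i
  · rw [hB.inner_rho hx q r rfl, one_mul, one_mul]
    exact mul_pos (hB.pos r) (hB.sineSeq_pos hS hfin hk)

end BipartiteSystem

end Positivity

/-! ### The vectors `μ` -/

section Mu

variable {n : ℕ} [NeZero n] {α β : Fin n → E n}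

theorem inner_cyc (hd : IsDualBasis α β) (i j : ℕ) :
    ⟪cyc β i, cyc α j⟫_ℝ = if (i - 1) % n = (j - 1) % n then 1 else 0 := by
  rw [cyc, cyc, hd]
  simp [Fin.ext_iff]

theorem prefixProd_cyc_dual (hu : ∀ i, ‖α i‖ = 1) (hd : IsDualBasis α β) {i k m : ℕ} (hkm : k ≤ m)
    (h : ∀ j, k ≤ j → j < m → (i - 1) % n ≠ j % n) :
    prefixProd α m (cyc β i) = prefixProd α k (cyc β i) := by
  induction m, hkm using Nat.le_induction with
  | base => rfl
  | succ m hkm ih =>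
    rw [prefixProd_succ, LinearIsometryEquiv.coe_mul, Function.comp_apply,
      reflectionIn_apply_of_unit (v := cyc α _) (hu _), real_inner_comm, inner_cyc hd, Nat.add_sub_cancel,
      if_neg (h m hkm m.lt_succ_self), mul_zero, zero_smul, sub_zero,
      ih fun j h1 h2 => h j h1 (by omega)]

theorem mod_ne_mod_of_lt {j m n : ℕ} (h1 : j < m) (h2 : m < j + n) : m % n ≠ j % n := by
  intro h
  have := (Nat.modEq_iff_dvd' h1.le).mp h.symm
  have := Nat.le_of_dvd (by omega) this
  omega

theorem mu_eq_prefixProd (hu : ∀ i, ‖α i‖ = 1) (hd : IsDualBasis α β) {i t : ℕ} (hi : 1 ≤ i)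
    (ht : t < n) : mu α β (i + t) = prefixProd α (i - 1) (cyc β (i + t)) :=
  prefixProd_cyc_dual hu hd (by omega) fun j h1 h2 => mod_ne_mod_of_lt h2 (by omega)

theorem mu_val_succ (hu : ∀ i, ‖α i‖ = 1) (hd : IsDualBasis α β) (r : Fin n) :
    mu α β (r + 1) = β r := by
  rw [add_comm, mu_eq_prefixProd hu hd le_rfl r.2, add_comm, cyc_val_succ]
  rfl

theorem mu_add_mul (q : ℕ) {i : ℕ} (hi : 1 ≤ i) :
    mu α β (q * n + i) = (coxeterElement α ^ q) (mu α β i) := by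
  rw [mu, mu, cyc_add_mul β hi, Nat.add_sub_assoc hi, prefixProd_mul_add, prefixProd_self]
  rfl

theorem rho_add_mul (q : ℕ) {i : ℕ} (hi : 1 ≤ i) :
    rho α (q * n + i) = (coxeterElement α ^ q) (rho α i) := by
  rw [rho, rho, cyc_add_mul α hi, Nat.add_sub_assoc hi, prefixProd_mul_add, prefixProd_self]
  rfl

/-- Among the letters `i, …, i + n - 1` only the first moves `β_i`, sending it to `β_i - 2 α_i`. -/
theorem mu_add_period (hu : ∀ i, ‖α i‖ = 1) (hd : IsDualBasis α β) {i : ℕ} (hi : 1 ≤ i) :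
    mu α β (i + n) = mu α β i - (2 : ℝ) • rho α i := by
  have hn : 0 < n := Nat.pos_of_neZero n
  have hc : cyc β (i + n) = cyc β i := by
    have := cyc_add_mul β hi 1
    rwa [one_mul, add_comm] at this
  rw [mu, hc, prefixProd_cyc_dual hu hd (k := i) (by omega)]
  · obtain ⟨i, rfl⟩ := Nat.exists_eq_add_of_le' hi
    rw [prefixProd_succ, LinearIsometryEquiv.coe_mul, Function.comp_apply,
      reflectionIn_apply_of_unit (v := cyc α _) (hu _), real_inner_comm, inner_cyc hd, if_pos rfl, mul_one,
      map_sub, map_smul]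
    rfl
  · exact fun j h1 h2 => (mod_ne_mod_of_lt (by omega) (by omega)).symm

theorem inner_mu_rho_eq_neg (hu : ∀ i, ‖α i‖ = 1) (hd : IsDualBasis α β) {i j : ℕ} (hi : 1 ≤ i)
    (hj : 1 ≤ j) : ⟪mu α β i, rho α j⟫_ℝ = -⟪mu α β (j + n), rho α i⟫_ℝ := by
  have hγ : ∀ k, 1 ≤ k → coxeterElement α (mu α β k) = mu α β k - (2 : ℝ) • rho α k :=
    fun k hk => by
      rw [← mu_add_period hu hd hk, add_comm]
      have := mu_add_mul (α := α) (β := β) 1 hk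
      rw [one_mul, pow_one] at this
      exact this.symm
  have h1 := (coxeterElement α).inner_map_map (mu α β i) (mu α β j)
  rw [hγ i hi, hγ j hj] at h1
  rw [mu_add_period hu hd hj]
  simp only [inner_sub_left, inner_sub_right, inner_smul_left, inner_smul_right,
    conj_trivial] at h1 ⊢
  rw [real_inner_comm (rho α i) (mu α β j), real_inner_comm (rho α i) (rho α j)]
  linarith

theorem inner_mu_add_rho (hu : ∀ i, ‖α i‖ = 1) (hd : IsDualBasis α β) {i t : ℕ} (hi : 1 ≤ i)
    (ht : 1 ≤ t) (htn : t < n) : ⟪mu α β (i + t), rho α i⟫_ℝ = 0 := by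
  rw [mu_eq_prefixProd hu hd hi htn, rho, LinearIsometryEquiv.inner_map_map, inner_cyc hd, if_neg]
  exact mod_ne_mod_of_lt (by omega) (by omega)

end Mu

/-- All that is used of the chamber is that it equals the open cone and avoids every reflecting
hyperplane. -/
theorem IsInwardUnitNormals.isSimpleSystem {n : ℕ} {W : Subgroup (O n)} {C : Set (E n)}
    {α β : Fin n → E n} (hα : IsInwardUnitNormals W C α) (hC : IsChamber W C)
    (hβ : IsDualBasis α β) : IsSimpleSystem W α β where
  unit := hα.unit
  refl_mem := hα.refl_mem
  dual := hβ
  regular v hv x hx := by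
    obtain ⟨y, -, hCy⟩ := hC
    have hxC : x ∈ C := by rw [hα.chamber_eq]; exact hx
    have hreg : x ∈ regularSet W := connectedComponentIn_subset _ _ (hCy ▸ hxC)
    exact hreg v hv.1 hv.2

end ReflGroup

end

theorem theorem3p2 {n : ℕ} [NeZero n]
    -- a finite irreducible real reflection group of rank `n`
    (W : Subgroup (ReflGroup.O n)) (hW : ReflGroup.IsFiniteIrreducible W)
    -- a fundamental chamber and its inward unit normals
    (C : Set (ReflGroup.E n)) (hC : ReflGroup.IsChamber W C)
    (α : Fin n → ReflGroup.E n) (hα : ReflGroup.IsInwardUnitNormals W C α)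
    -- ordered so that the first `s` and the last `n - s` are orthonormal sets
    (s : ℕ) (hs : s ≤ n)
    (hS₁ : Orthonormal ℝ fun i : {i : Fin n // (i : ℕ) < s} => α i)
    (hS₂ : Orthonormal ℝ fun i : {i : Fin n // s ≤ (i : ℕ)} => α i)
    -- the dual basis
    (β : Fin n → ReflGroup.E n) (hβ : ReflGroup.IsDualBasis α β)
    -- the order of the Coxeter element
    (h : ℕ) (hh : h = orderOf (ReflGroup.coxeterElement α)) :
    (∀ i j : ℕ, 1 ≤ i → 1 ≤ j →
      ⟪ReflGroup.mu α β i, ReflGroup.rho α j⟫_ℝ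
        = -⟪ReflGroup.mu α β (j + n), ReflGroup.rho α i⟫_ℝ) ∧
    (∀ i j : ℕ, 1 ≤ i → i ≤ j → j ≤ n * h / 2 →
      0 ≤ ⟪ReflGroup.mu α β i, ReflGroup.rho α j⟫_ℝ) ∧
    (∀ i t : ℕ, 1 ≤ i → 1 ≤ t → t ≤ n - 1 →
      ⟪ReflGroup.mu α β (i + t), ReflGroup.rho α i⟫_ℝ = 0) ∧
    (∀ i j : ℕ, 1 ≤ i → i < j → j ≤ n * h / 2 →
      ⟪ReflGroup.mu α β j, ReflGroup.rho α i⟫_ℝ ≤ 0) := by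
  have hS := hα.isSimpleSystem hC hβ
  obtain ⟨lam, c, hc, hev⟩ := hS.exists_pos_gram_eigenvector hW
  have hB : ReflGroup.BipartiteSystem α β s lam c :=
    { le := hs
      unit := hα.unit
      dual := hβ
      orth_left := fun i j hi hj hij =>
        hS₁.2 (i := ⟨i, hi⟩) (j := ⟨j, hj⟩) (by simpa [Subtype.ext_iff] using hij)
      orth_right := fun i j hi hj hij =>
        hS₂.2 (i := ⟨i, hi⟩) (j := ⟨j, hj⟩) (by simpa [Subtype.ext_iff] using hij)
      pos := hc
      eigen := hev }
  have hn : 0 < n := Nat.pos_of_neZero n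
  subst hh
  have hb : ∀ i j : ℕ, 1 ≤ i → i ≤ j → j ≤ n * orderOf (ReflGroup.coxeterElement α) / 2 →
      0 ≤ ⟪ReflGroup.mu α β i, ReflGroup.rho α j⟫_ℝ := by
    intro i j hi hij hj
    obtain ⟨q, r, rfl⟩ : ∃ (q : ℕ) (r : Fin n), i = q * n + (r + 1) :=
      ⟨(i - 1) / n, ⟨(i - 1) % n, Nat.mod_lt _ hn⟩, by
        have := Nat.div_add_mod' (i - 1) n
        simp only; omega⟩
    -- As `j ≥ i`, the same power `γ^q` splits off from both vectors, and lowering `j` keeps it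
    -- within the bound.
    obtain ⟨k, rfl⟩ : ∃ k, j = q * n + k := ⟨j - q * n, by omega⟩
    rw [ReflGroup.mu_add_mul q (by omega), ReflGroup.rho_add_mul q (by omega),
      LinearIsometryEquiv.inner_map_map, ReflGroup.mu_val_succ hα.unit hβ]
    exact hB.coeff_rho_nonneg hS (by omega) (by omega) r
  refine ⟨fun i j hi hj => ReflGroup.inner_mu_rho_eq_neg hα.unit hβ hi hj, hb,
    fun i t hi ht htn => ReflGroup.inner_mu_add_rho hα.unit hβ hi ht (by omega), ?_⟩
  intro i j hi hij hj
  rcases Nat.lt_or_ge j (i + n) with hlt | hge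
  · obtain ⟨t, rfl⟩ := Nat.exists_eq_add_of_le hij.le
    exact (ReflGroup.inner_mu_add_rho hα.unit hβ hi (by omega) (by omega)).le
  · obtain ⟨k, rfl⟩ : ∃ k, j = k + n := ⟨j - n, by omega⟩
    have h1 := ReflGroup.inner_mu_rho_eq_neg hα.unit hβ (i := i) (j := k) hi (by omega)
    have h2 := hb i k hi (by omega) (by omega)
    linarith
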